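/- Let $N>2$ and $L\ge 0$ be integers and $q_0=e^{i\pi/N}$. Let $k_+,k_-,\epsilon_0,\epsilon_1$ be complex parameters, constant or depending on $q$, and continuous at $q_0$. With $\sigma_+=\begin{pmatrix}0&1\\0&0\end{pmatrix}$, $\sigma_-=\begin{pmatrix}0&0\\1&0\end{pmatrix}$, $\sigma_z=\mathrm{diag}(1,-1)$ and $w_0=k_+\sigma_++k_-\sigma_-$, define on $(\mathbb C^2)^{\otimes L}$ the operators $$\mathcal W_0=\sum_{j=1}^L (q^{\sigma_z})^{\otimes (j-1)}\otimes w_0\otimes \mathbb I^{\otimes (L-j)}+\epsilon_0\,(q^{\sigma_z})^{\otimes L},\qquad \mathcal W_1=\sum_{j=1}^L (q^{-\sigma_z})^{\otimes (j-1)}\otimes w_0\otimes \mathbb I^{\otimes (L-j)}+\epsilon_1\,(q^{-\sigma_z})^{\otimes L}.$$ Fix $i\in\{0,1\}$ and assume that the parameters of $\mathcal W_i$ are generic at $q_0$ in the sense that $\epsilon_i^2\sin^2(\pi/N)\neq k_+k_-\cos^2(m\pi/N)$ for all $m\in\mathbb Z$. (a) There are functions $a_2,a_3$ of $q$, continuous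 at $q_0$, with $a_2+a_3=\epsilon_i$ and $a_2a_3=-k_+k_- /(q-q^{-1})^2$ near $q_0$. If $\epsilon_i=\cosh\alpha$, $k_+=-(q-q^{-1})e^{i\eta}/2$ and $k_-=(q-q^{-1})e^{-i\eta}/2$ near $q_0$ with constants $\alpha,\eta\in\mathbb C$, one may take $a_2=e^{\alpha}/2$, $a_3=e^{-\alpha}/2$; if $k_-=0$ near $q_0$, one may take $a_2=\epsilon_i$, $a_3=0$. For every such pair $(a_2,a_3)$, put $\theta_n(q)=a_2q^{L-2n}+a_3q^{-L+2n}$. Then: (b) For all $q\ne q_0$ close enough to $q_0$, the numbers $\theta_0(q),\dots,\theta_L(q)$ are pairwise distinct, and the eigenspace $V_n(q)$ of $\mathcal W_i$ for $\theta_n(q)$ has dimension $\binom Ln$ for $0\le n\le L$. For every $n\ge0$ let $V_n$ be the space of all limits, as $q\to q_0$, $q\neq q_0$, of vectors $v(q)\in V_n(q)$; it has dimension $\binom Ln$ (so $V_n$ is the limit of the subspaces $V_n(q)$, and $V_n=0$ for $n>L$). (c) At $q=q_0$ the numbers $\theta_t=\theta_t(q_0)$, $t=0,\dots,N-1$, are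 pairwise distinct, and, if $L\ge N-1$, they are exactly the eigenvalues of $\mathcal W_i$, which therefore has exactly $N$ distinct eigenvalues. The eigenspaces $V_t^{(N)}=\ker(\mathcal W_i-\theta_t)$, $0\le t\le N-1$, at $q_0$ span $(\mathbb C^2)^{\otimes L}$, i.e. $\mathcal W_i$ is diagonalizable. (d) $V_t^{(N)}=\bigoplus_{k=0}^{\lfloor L/N\rfloor}V_{t+kN}$ for $0\le t\le N-1$. (e) At $q=q_0$, for $0\le t\le N-1$, $\ \mathcal W_iV_t^{(N)}\subseteq V_t^{(N)}$ and $\ \mathcal W_{1-i}V_t^{(N)}\subseteq V_{t+1}^{(N)}+V_t^{(N)}+V_{t-1}^{(N)}$, where indices are taken modulo $N$: $V_{-1}^{(N)}=V_{N-1}^{(N)}$, $V_N^{(N)}=V_0^{(N)}$. (The case $i=0$ concerns the eigenspaces $V_t^{(N)}$ of $\mathcal W_0$, the case $i=1$ the dual eigenspaces $V_t^{*(N)}$ of $\mathcal W_1$.) -/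

import Mathlib

open Filter Topology

noncomputable section

namespace XXZ

/-- The Pauli matrix `σ₊`. -/
def sigmaPlus : Matrix (Fin 2) (Fin 2) ℂ := !![0, 1; 0, 0]

/-- The Pauli matrix `σ₋`. -/
def sigmaMinus : Matrix (Fin 2) (Fin 2) ℂ := !![0, 0; 1, 0]

/-- `q ^ σ_z` with `σ_z = diag(1, -1)`; in particular `q ^ (-σ_z)` is `qPowSigmaZ q⁻¹`. -/
def qPowSigmaZ (q : ℂ) : Matrix (Fin 2) (Fin 2) ℂ := !![q, 0; 0, q⁻¹]

/-- `w₀ = k₊ σ₊ + k₋ σ₋`. -/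
def w0 (kp km : ℂ) : Matrix (Fin 2) (Fin 2) ℂ := kp • sigmaPlus + km • sigmaMinus

/-- The coordinate space of `(ℂ²)^{⊗ L}`: the standard basis vectors
`e_{x 0} ⊗ ⋯ ⊗ e_{x (L-1)}` are indexed by `x : Fin L → Fin 2`. -/
abbrev ChainSpace (L : ℕ) : Type := (Fin L → Fin 2) → ℂ

/-- The matrix of `A 0 ⊗ A 1 ⊗ ⋯ ⊗ A (L-1)` in the standard basis of `(ℂ²)^{⊗ L}`
(iterated Kronecker product). -/
def tensorOp {L : ℕ} (A : Fin L → Matrix (Fin 2) (Fin 2) ℂ) :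
    Matrix (Fin L → Fin 2) (Fin L → Fin 2) ℂ :=
  Matrix.of fun x y => ∏ j, A j (x j) (y j)

/-- `∑ⱼ p^{σ_z} ⊗ ⋯ ⊗ p^{σ_z} ⊗ w₀ (site j) ⊗ 𝕀 ⊗ ⋯ ⊗ 𝕀 + ε p^{σ_z} ⊗ ⋯ ⊗ p^{σ_z}`. -/
def basicMatrix (L : ℕ) (kp km ε p : ℂ) : Matrix (Fin L → Fin 2) (Fin L → Fin 2) ℂ :=
  (∑ j : Fin L, tensorOp fun m : Fin L =>
      if m < j then qPowSigmaZ p else if m = j then w0 kp km else 1)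
    + ε • tensorOp fun _ : Fin L => qPowSigmaZ p

/-- The basic operator `𝒲ᵢ`: built with `q^{σ_z}` for `i = 0` and with `q^{-σ_z}` for `i = 1`;
here `ε` is `ε₀ = ε₊` for `i = 0` and `ε₁ = ε₋` for `i = 1`. -/
def W (L : ℕ) (i : Fin 2) (kp km ε q : ℂ) : Module.End ℂ (ChainSpace L) :=
  Matrix.toLin' (basicMatrix L kp km ε (if i = 0 then q else q⁻¹))

/-- `θ_n = a₂ q^{L-2n} + a₃ q^{-L+2n}`. -/
def theta (L : ℕ) (a₂ a₃ q : ℂ) (n : ℕ) : ℂ :=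
  a₂ * q ^ ((L : ℤ) - 2 * (n : ℤ)) + a₃ * q ^ (-(L : ℤ) + 2 * (n : ℤ))

/-- The coefficient functions `a₂, a₃` of the spectrum attached to the (possibly `q`-dependent)
parameters `k₊, k₋, ε` near the point `q₀`: a continuous choice of the two roots of
`X² - ε X - k₊ k₋ / (q - q⁻¹)²`. -/
structure IsCoeffPair (q₀ : ℂ) (kp km ε a₂ a₃ : ℂ → ℂ) : Prop where
  continuousAt_left : ContinuousAt a₂ q₀
  continuousAt_right : ContinuousAt a₃ q₀
  add_eq : ∀ᶠ q in 𝓝 q₀, a₂ q + a₃ q = ε q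
  mul_eq : ∀ᶠ q in 𝓝 q₀, a₂ q * a₃ q = -(kp q * km q) / (q - q⁻¹) ^ 2

/-- The limit, along the filter `l`, of a family of subspaces: the space of all limits of
sections `q ↦ f q ∈ F q`. When the `F q` have constant finite dimension `d`, the family
converges in the Grassmannian exactly if this space has dimension `d`, and it then is the
limit. -/
def subspaceLimit {E : Type*} [AddCommGroup E] [Module ℂ E] [TopologicalSpace E]
    [ContinuousAdd E] [ContinuousConstSMul ℂ E]
    (l : Filter ℂ) (F : ℂ → Submodule ℂ E) : Submodule ℂ E where
  carrier := {v | ∃ f : ℂ → E, (∀ᶠ q in l, f q ∈ F q) ∧ Tendsto f l (𝓝 v)}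
  add_mem' := by
    rintro v w ⟨f, hf, hfv⟩ ⟨g, hg, hgw⟩
    exact ⟨fun q => f q + g q, by filter_upwards [hf, hg] with q h1 h2 using (F q).add_mem h1 h2,
      hfv.add hgw⟩
  zero_mem' := ⟨fun _ => 0, Eventually.of_forall fun q => (F q).zero_mem, tendsto_const_nhds⟩
  smul_mem' := by
    rintro c v ⟨f, hf, hfv⟩
    exact ⟨fun q => c • f q, by filter_upwards [hf] with q h using (F q).smul_mem c h,
      hfv.const_smul c⟩

/-- For generic `q`, the eigenspace `V_n(q)` of `𝒲ᵢ` (for the parameters at `q`) with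
eigenvalue `θ_n(q)`. -/
def genericEigenspace (L : ℕ) (i : Fin 2) (kp km ε a₂ a₃ : ℂ → ℂ) (n : ℕ) (q : ℂ) :
    Submodule ℂ (ChainSpace L) :=
  Module.End.eigenspace (W L i (kp q) (km q) (ε q) q) (theta L (a₂ q) (a₃ q) q n)

/-- `V_n` at `q₀` (`V_n` for `i = 0`, `V*_n` for `i = 1`): the eigenspace `V_n(q)` of
generic `q`, evaluated at `q₀` as the limit `q → q₀`, `q ≠ q₀`. -/
def V (L : ℕ) (i : Fin 2) (q₀ : ℂ) (kp km ε a₂ a₃ : ℂ → ℂ) (n : ℕ) :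
    Submodule ℂ (ChainSpace L) :=
  subspaceLimit (𝓝[≠] q₀) (genericEigenspace L i kp km ε a₂ a₃ n)

/-- `V_t^{(N)}` (`i = 0`), resp. `V_t^{*(N)}` (`i = 1`): the eigenspace of `𝒲ᵢ` at `q₀`
itself with eigenvalue `θ_t(q₀)`. -/
def VN (L : ℕ) (i : Fin 2) (q₀ : ℂ) (kp km ε a₂ a₃ : ℂ → ℂ) (t : ℕ) :
    Submodule ℂ (ChainSpace L) :=
  Module.End.eigenspace (W L i (kp q₀) (km q₀) (ε q₀) q₀) (theta L (a₂ q₀) (a₃ q₀) q₀ t)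

end XXZ

end

/-!
The operator `𝒲ᵢ` is `ℬ_L = ∑ⱼ p^{σ_z} ⊗ ⋯ ⊗ w₀ ⊗ ⋯ ⊗ 𝕀 + ε (p^{σ_z})^{⊗ L}` with `p = q` or `p = q⁻¹`.
It has an explicit basis of eigenvectors that are product vectors. Splitting off the last factor,
`ℬ_{L+1} = 𝒜_L ⊗ 𝕀 + (p^{σ_z})^{⊗ L} ⊗ (w₀ + ε p^{σ_z})`, so that on `v ⊗ f`, where `f` is an
eigenvector of the `2 × 2` matrix `w₀ + ε p^{σ_z}` for `ν`, it acts as `ℬ_L` with the parameter `ν` in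
place of `ε`. If `ε = a + a'` and `a a' = -k₊ k₋ / (p - p⁻¹)²`, the two values of `ν` are
`a p + a' p⁻¹` and `a p⁻¹ + a' p`, which are again of this form with the same product `a a'`. By
induction the eigenvalues are `θ_n = a p^{L-2n} + a' p^{-L+2n}`, where `n` is the number of second
choices. All the `2 × 2` matrices that occur have distinct eigenvalues as long as
`a p^m ≠ a' p^{-m}`, and at `q₀` this is precisely the genericity of the parameters
(`IsCoeffPair.mul_zpow_ne`). Hence the basis extends continuously through `q₀`
(`exists_diagonalization`), where the operator is therefore diagonalizable too.

In this basis the eigenspaces at generic `q`, their limits and the eigenspaces at `q₀` are all spanned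
by subsets of the basis: those of weight `n`, respectively those of weight `≡ t` modulo `N`. The
factorization of `θ_m - θ_n` (`theta_sub_theta`) tells which eigenvalues coincide, `q₀²` being a
primitive `N`-th root of unity.

The action of the other operator follows from the `q`-Dolan–Grady relation, which is inherited
from `L` to `L + 1` by splitting off the first factor (`DolanGrady.block`). On an eigenvector for
`θ_n` it forces the eigenvalue `x` of a component of the image to satisfy
`(x - θ_n) (x - θ_{n+1}) (x - θ_{n-1}) = 0` (`DolanGrady.map_eigenspace_le`).
-/

namespace XXZ

/-! ### Subspaces cut out by vanishing coordinates -/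

section Coordinates

variable {X : Type*} [Fintype X]

/-- The vectors whose coordinates outside `S` vanish, where the coordinates of `v` are the entries
of `Q *ᵥ v`. If `Q = P⁻¹`, this is the span of the columns of `P` with index in `S`. -/
def coordSubspace (Q : Matrix X X ℂ) (S : Set X) : Submodule ℂ (X → ℂ) where
  carrier := {v | ∀ s ∉ S, Q.mulVec v s = 0}
  add_mem' := by
    intro v w hv hw s hs
    simp [Matrix.mulVec_add, hv s hs, hw s hs]
  zero_mem' := by simp
  smul_mem' := by
    intro c v hv s hs
    simp [Matrix.mulVec_smul, hv s hs]

theorem mem_coordSubspace {Q : Matrix X X ℂ} {S : Set X} {v : X → ℂ} :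
    v ∈ coordSubspace Q S ↔ ∀ s ∉ S, Q.mulVec v s = 0 := Iff.rfl

theorem coordSubspace_mono {Q : Matrix X X ℂ} {S T : Set X} (h : S ⊆ T) :
    coordSubspace Q S ≤ coordSubspace Q T :=
  fun _ hv s hs => hv s fun h' => hs (h h')

variable [DecidableEq X] {P Q : Matrix X X ℂ}

theorem mulVec_mulVec_of_mul_eq_one (h : Q * P = 1) (v : X → ℂ) :
    Q.mulVec (P.mulVec v) = v := by
  rw [Matrix.mulVec_mulVec, h, Matrix.one_mulVec]

theorem finrank_coordSubspace (h : Q * P = 1) (S : Set X) :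
    Module.finrank ℂ (coordSubspace Q S) = S.ncard := by
  classical
  let f : (X → ℂ) →ₗ[ℂ] ((Sᶜ : Set X) → ℂ) :=
    LinearMap.funLeft ℂ ℂ (Subtype.val : (Sᶜ : Set X) → X) ∘ₗ Matrix.toLin' Q
  have hker : coordSubspace Q S = LinearMap.ker f := by
    ext v
    simp only [mem_coordSubspace, LinearMap.mem_ker, f, funext_iff]
    exact ⟨fun hv s => hv s s.2, fun hv s hs => hv ⟨s, hs⟩⟩
  have hsurj : LinearMap.range f = ⊤ := by
    rw [LinearMap.range_eq_top]
    intro w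
    refine ⟨P.mulVec fun s => if hs : s ∈ (Sᶜ : Set X) then w ⟨s, hs⟩ else 0, ?_⟩
    ext s
    have hs : s.1 ∉ S := s.2
    simp [f, LinearMap.funLeft, mulVec_mulVec_of_mul_eq_one h, hs]
  have hrank := LinearMap.finrank_range_add_finrank_ker f
  rw [hsurj, ← hker, finrank_top, Module.finrank_fintype_fun_eq_card,
    Module.finrank_fintype_fun_eq_card] at hrank
  have hcard := Set.ncard_add_ncard_compl S
  rw [Nat.card_eq_fintype_card] at hcard
  have hcompl : Fintype.card (Sᶜ : Set X) = (Sᶜ : Set X).ncard := by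
    rw [← Nat.card_coe_set_eq, Nat.card_eq_fintype_card]
  omega

theorem coordSubspace_sup (h : Q * P = 1) (S T : Set X) :
    coordSubspace Q S ⊔ coordSubspace Q T = coordSubspace Q (S ∪ T) := by
  classical
  refine le_antisymm (sup_le (coordSubspace_mono Set.subset_union_left)
    (coordSubspace_mono Set.subset_union_right)) fun v hv => ?_
  rw [Submodule.mem_sup]
  refine ⟨P.mulVec (S.indicator (Q.mulVec v)), fun s hs => ?_,
    P.mulVec (Sᶜ.indicator (Q.mulVec v)), fun s hs => ?_, ?_⟩
  · simp [mulVec_mulVec_of_mul_eq_one h, hs]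
  · rw [mulVec_mulVec_of_mul_eq_one h]
    by_cases hS : s ∈ S
    · simp [hS]
    · simpa [hS] using hv s (by simp [hS, hs])
  · rw [← Matrix.mulVec_add, Set.indicator_self_add_compl,
      mulVec_mulVec_of_mul_eq_one (mul_eq_one_comm.1 h)]

theorem coordSubspace_iUnion (h : Q * P = 1) {n : ℕ} (S : Fin n → Set X) :
    (⨆ k, coordSubspace Q (S k)) = coordSubspace Q (⋃ k, S k) := by
  classical
  refine le_antisymm (iSup_le fun k => coordSubspace_mono (Set.subset_iUnion S k)) fun v hv => ?_
  -- the expansion of `v` along the columns of `P`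
  have hsum : v = ∑ s, P.mulVec (Pi.single s (Q.mulVec v s)) := by
    rw [← Matrix.mulVec_sum, Finset.univ_sum_single,
      mulVec_mulVec_of_mul_eq_one (mul_eq_one_comm.1 h)]
  rw [hsum]
  refine Submodule.sum_mem _ fun s _ => ?_
  by_cases hs : s ∈ ⋃ k, S k
  · obtain ⟨k, hk⟩ := Set.mem_iUnion.1 hs
    refine Submodule.mem_iSup_of_mem k fun r hr => ?_
    rw [mulVec_mulVec_of_mul_eq_one h, Pi.single_eq_of_ne]
    rintro rfl
    exact hr hk
  · rw [hv s hs, Pi.single_zero, Matrix.mulVec_zero]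
    exact Submodule.zero_mem _

theorem disjoint_coordSubspace (h : Q * P = 1) {S T : Set X} (hST : Disjoint S T) :
    Disjoint (coordSubspace Q S) (coordSubspace Q T) := by
  rw [Submodule.disjoint_def]
  intro v hS hT
  rw [← mulVec_mulVec_of_mul_eq_one (mul_eq_one_comm.1 h) v]
  have hv : Q.mulVec v = 0 := by
    ext s
    by_cases hs : s ∈ S
    · exact hT s (Set.disjoint_left.1 hST hs)
    · exact hS s hs
  rw [hv, Matrix.mulVec_zero]

theorem iSupIndep_coordSubspace (h : Q * P = 1) {ι : Type*} (S : ι → Set X)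
    (hS : Pairwise fun j k => Disjoint (S j) (S k)) :
    iSupIndep fun k => coordSubspace Q (S k) := by
  intro k
  refine (disjoint_coordSubspace h (disjoint_compl_right (a := S k))).mono_right
    (iSup₂_le fun j hj => coordSubspace_mono ?_)
  exact (hS hj).subset_compl_right

theorem mul_eq_diagonal_mul {M : Matrix X X ℂ} {d : X → ℂ} (h : Q * P = 1)
    (hM : M * P = P * Matrix.diagonal d) : Q * M = Matrix.diagonal d * Q := by
  calc Q * M = Q * (M * P) * Q := by
        rw [Matrix.mul_assoc, Matrix.mul_assoc, mul_eq_one_comm.1 h, Matrix.mul_one]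
    _ = Matrix.diagonal d * Q := by rw [hM, ← Matrix.mul_assoc, h, Matrix.one_mul]

theorem eigenspace_eq_coordSubspace {M : Matrix X X ℂ} {d : X → ℂ} (h : Q * P = 1)
    (hM : M * P = P * Matrix.diagonal d) (μ : ℂ) :
    Module.End.eigenspace (Matrix.toLin' M) μ = coordSubspace Q {s | d s = μ} := by
  have hinj : Function.Injective Q.mulVec :=
    Function.LeftInverse.injective (g := P.mulVec)
      (mulVec_mulVec_of_mul_eq_one (mul_eq_one_comm.1 h))
  ext v
  rw [Module.End.mem_eigenspace_iff, Matrix.toLin'_apply, ← hinj.eq_iff, Matrix.mulVec_mulVec,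
    mul_eq_diagonal_mul h hM,
    ← Matrix.mulVec_mulVec, Matrix.mulVec_smul, funext_iff, mem_coordSubspace]
  refine forall_congr' fun s => ?_
  rw [Matrix.mulVec_diagonal, Pi.smul_apply, smul_eq_mul, mul_eq_mul_right_iff, Set.mem_ofPred_eq,
    or_iff_not_imp_left]

theorem hasEigenvalue_toLin'_iff {M : Matrix X X ℂ} {d : X → ℂ} (h : Q * P = 1)
    (hM : M * P = P * Matrix.diagonal d) (μ : ℂ) :
    Module.End.HasEigenvalue (Matrix.toLin' M) μ ↔ ∃ s, d s = μ := by
  rw [Module.End.hasEigenvalue_iff, eigenspace_eq_coordSubspace h hM, ← not_iff_not, not_not,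
    ← Submodule.finrank_eq_zero (R := ℂ), finrank_coordSubspace h, Set.ncard_eq_zero,
    Set.eq_empty_iff_forall_notMem]
  simp

/-- Coordinate subspaces depend continuously on the basis. -/
theorem subspaceLimit_eq_coordSubspace {l : Filter ℂ} [l.NeBot] {F : ℂ → Submodule ℂ (X → ℂ)}
    {P Q : ℂ → Matrix X X ℂ} {P₀ Q₀ : Matrix X X ℂ} {S : Set X}
    (hP : Tendsto P l (𝓝 P₀)) (hQ : Tendsto Q l (𝓝 Q₀)) (h₀ : Q₀ * P₀ = 1)
    (h : ∀ᶠ q in l, Q q * P q = 1) (hF : ∀ᶠ q in l, F q = coordSubspace (Q q) S) :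
    subspaceLimit l F = coordSubspace Q₀ S := by
  have hcont : Continuous fun x : Matrix X X ℂ × (X → ℂ) => x.1.mulVec x.2 :=
    continuous_fst.matrix_mulVec continuous_snd
  ext v
  constructor
  · rintro ⟨f, hf, hfv⟩ s hs
    have hlim : Tendsto (fun q => (Q q).mulVec (f q) s) l (𝓝 (Q₀.mulVec v s)) :=
      tendsto_pi_nhds.1 ((hcont.tendsto (Q₀, v)).comp (hQ.prodMk_nhds hfv)) s
    refine tendsto_nhds_unique hlim (tendsto_const_nhds.congr' ?_)
    filter_upwards [hf, hF] with q h1 h2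
    rw [h2] at h1
    exact (h1 s hs).symm
  · intro hv
    refine ⟨fun q => (P q).mulVec (Q₀.mulVec v), ?_, ?_⟩
    · filter_upwards [h, hF] with q h1 h2
      rw [h2]
      intro s hs
      rw [mulVec_mulVec_of_mul_eq_one h1]
      exact hv s hs
    · have := (hcont.tendsto (P₀, Q₀.mulVec v)).comp (hP.prodMk_nhds tendsto_const_nhds)
      rwa [mulVec_mulVec_of_mul_eq_one (mul_eq_one_comm.1 h₀)] at this

end Coordinates

/-! ### A product eigenbasis -/

theorem sum_snoc {L : ℕ} (f : (Fin (L + 1) → Fin 2) → ℂ) :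
    ∑ x, f x = ∑ y : Fin L → Fin 2, ∑ a, f (Fin.snoc y a) := by
  rw [← (Fin.snocEquiv fun _ => Fin 2).sum_comp, Fintype.sum_prod_type_right]
  rfl

/-- The last tensor factor split off: for `𝒜_L = ℬ_L` at `ε = 0`,
`ℬ_{L+1} = 𝒜_L ⊗ 𝕀 + (p^{σ_z})^{⊗ L} ⊗ (w₀ + ε p^{σ_z})`. -/
theorem basicMatrix_succ_snoc (L : ℕ) (kp km ε p : ℂ) (x y : Fin L → Fin 2) (a b : Fin 2) :
    basicMatrix (L + 1) kp km ε p (Fin.snoc x a) (Fin.snoc y b) =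
      basicMatrix L kp km 0 p x y * (1 : Matrix (Fin 2) (Fin 2) ℂ) a b +
      tensorOp (fun _ => qPowSigmaZ p) x y * (w0 kp km + ε • qPowSigmaZ p) a b := by
  have hsite (j : Fin L) : (∏ m : Fin (L + 1), (if m < j.castSucc then qPowSigmaZ p
      else if m = j.castSucc then w0 kp km else 1)
        ((Fin.snoc x a : Fin (L + 1) → Fin 2) m) ((Fin.snoc y b : Fin (L + 1) → Fin 2) m)) =
      (∏ m : Fin L, (if m < j then qPowSigmaZ p
      else if m = j then w0 kp km else 1) (x m) (y m)) * (1 : Matrix (Fin 2) (Fin 2) ℂ) a b := by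
    rw [Fin.prod_univ_castSucc, Fin.snoc_last, Fin.snoc_last]
    simp [(Fin.castSucc_lt_last j).not_gt, (Fin.castSucc_lt_last j).ne']
  simp only [basicMatrix, tensorOp, Matrix.add_apply, Matrix.sum_apply, Matrix.of_apply,
    Matrix.smul_apply, smul_eq_mul, Fin.sum_univ_castSucc, hsite, ← Finset.sum_mul]
  rw [Fin.prod_univ_castSucc, Fin.prod_univ_castSucc]
  simp [Fin.castSucc_lt_last]
  ring

/-- The `2 × 2` matrix `w₀ + (a + a') p^{σ_z}` has the eigenvalues `a p + a' p⁻¹` and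
`a p⁻¹ + a' p`; it is diagonalized by a matrix depending continuously on the parameters. -/
theorem exists_diagonalization_site {q₀ : ℂ} {kp km p a a' : ℂ → ℂ}
    (hkp : ContinuousAt kp q₀) (hkm : ContinuousAt km q₀) (hp : ContinuousAt p q₀)
    (ha : ContinuousAt a q₀) (ha' : ContinuousAt a' q₀)
    (hp0 : p q₀ ≠ 0) (hd : p q₀ - (p q₀)⁻¹ ≠ 0)
    (hmul : ∀ᶠ q in 𝓝 q₀, a q * a' q * (p q - (p q)⁻¹) ^ 2 = -(kp q * km q))
    (hne : a q₀ ≠ a' q₀) :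
    ∃ F G : ℂ → Matrix (Fin 2) (Fin 2) ℂ, ContinuousAt F q₀ ∧ ContinuousAt G q₀ ∧
      ∀ᶠ q in 𝓝 q₀, G q * F q = 1 ∧
        (w0 (kp q) (km q) + (a q + a' q) • qPowSigmaZ (p q)) * F q =
          F q * Matrix.diagonal
            ![a q * p q + a' q * (p q)⁻¹, a q * (p q)⁻¹ + a' q * p q] := by
  have hpinv : ContinuousAt (fun q => (p q)⁻¹) q₀ := hp.inv₀ hp0
  have hdc : ContinuousAt (fun q => p q - (p q)⁻¹) q₀ := hp.sub hpinv
  -- it is enough to find a continuous matrix of eigenvectors that is invertible at `q₀`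
  suffices h : ∃ F : ℂ → Matrix (Fin 2) (Fin 2) ℂ, ContinuousAt F q₀ ∧ (F q₀).det ≠ 0 ∧
      ∀ᶠ q in 𝓝 q₀, (w0 (kp q) (km q) + (a q + a' q) • qPowSigmaZ (p q)) * F q =
          F q * Matrix.diagonal
            ![a q * p q + a' q * (p q)⁻¹, a q * (p q)⁻¹ + a' q * p q] by
    obtain ⟨F, hF, hdet, hM⟩ := h
    have hdetc : ContinuousAt (fun q => (F q).det) q₀ :=
      (continuous_id.matrix_det).continuousAt.comp hF
    refine ⟨F, fun q => ((F q).det)⁻¹ • (F q).adjugate, hF,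
      (hdetc.inv₀ hdet).smul ((continuous_id.matrix_adjugate).continuousAt.comp hF), ?_⟩
    filter_upwards [hM, hdetc.eventually_ne hdet] with q h1 h2
    exact ⟨by rw [Matrix.smul_mul, Matrix.adjugate_mul, smul_smul, inv_mul_cancel₀ h2, one_smul],
      h1⟩
  -- With `d = p - p⁻¹`, eigenvectors are `(k₊, -a' d) ∼ (a d, k₋)` and `(k₊, -a d) ∼ (a' d, k₋)`;
  -- which choice gives independent columns at `q₀` depends on which of `a q₀`, `a' q₀` is nonzero.
  by_cases h0 : a q₀ = 0
  · have h0' : a' q₀ ≠ 0 := fun h => hne (h0.trans h.symm)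
    refine ⟨fun q => !![kp q, a' q * (p q - (p q)⁻¹); -(a' q * (p q - (p q)⁻¹)), km q], ?_, ?_, ?_⟩
    · refine continuousAt_pi.2 fun i => continuousAt_pi.2 fun j => ?_
      fin_cases i <;> fin_cases j
      exacts [hkp, ha'.mul hdc, (ha'.mul hdc).neg, hkm]
    · have h : a' q₀ * (p q₀ - (p q₀)⁻¹) ^ 2 * (a' q₀ - a q₀) ≠ 0 :=
        mul_ne_zero (mul_ne_zero h0' (pow_ne_zero 2 hd)) (sub_ne_zero.2 hne.symm)
      rw [Matrix.det_fin_two_of]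
      refine fun h' => h ?_
      linear_combination h' - hmul.self_of_nhds
    · filter_upwards [hmul, hp.eventually_ne hp0] with q h hpq
      ext i j
      fin_cases i <;> fin_cases j <;>
        simp [w0, sigmaPlus, sigmaMinus, qPowSigmaZ, Matrix.mul_apply, Fin.sum_univ_two]
      · ring
      · linear_combination h
      · linear_combination h
      · ring
  · refine ⟨fun q => !![a q * (p q - (p q)⁻¹), kp q; km q, -(a q * (p q - (p q)⁻¹))], ?_, ?_, ?_⟩
    · refine continuousAt_pi.2 fun i => continuousAt_pi.2 fun j => ?_
      fin_cases i <;> fin_cases j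
      exacts [ha.mul hdc, hkp, hkm, (ha.mul hdc).neg]
    · have h : a q₀ * (p q₀ - (p q₀)⁻¹) ^ 2 * (a' q₀ - a q₀) ≠ 0 :=
        mul_ne_zero (mul_ne_zero h0 (pow_ne_zero 2 hd)) (sub_ne_zero.2 hne.symm)
      rw [Matrix.det_fin_two_of]
      refine fun h' => h ?_
      linear_combination h' + hmul.self_of_nhds
    · filter_upwards [hmul, hp.eventually_ne hp0] with q h hpq
      ext i j
      fin_cases i <;> fin_cases j <;>
        simp [w0, sigmaPlus, sigmaMinus, qPowSigmaZ, Matrix.mul_apply, Fin.sum_univ_two]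
      · linear_combination h
      · ring
      · ring
      · linear_combination h

/-- The number of factors `e₁` in a standard basis vector. -/
def weight {L : ℕ} (s : Fin L → Fin 2) : ℕ := ∑ j, (s j : ℕ)

theorem weight_snoc {L : ℕ} (s : Fin L → Fin 2) (a : Fin 2) :
    weight (Fin.snoc s a : Fin (L + 1) → Fin 2) = weight s + a := by
  simp [weight, Fin.sum_univ_castSucc]

theorem theta_mul_inv (L : ℕ) {a a' p : ℂ} (hp : p ≠ 0) (n : ℕ) :
    theta L (a * p) (a' * p⁻¹) p n = theta (L + 1) a a' p n := by
  simp only [theta]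
  rw [mul_assoc, mul_assoc, ← zpow_one_add₀ hp, ← zpow_neg_one, ← zpow_add₀ hp]
  push_cast
  ring_nf

theorem theta_inv_mul (L : ℕ) {a a' p : ℂ} (hp : p ≠ 0) (n : ℕ) :
    theta L (a * p⁻¹) (a' * p) p n = theta (L + 1) a a' p (n + 1) := by
  simp only [theta]
  rw [mul_assoc, mul_assoc, ← zpow_one_add₀ hp, ← zpow_neg_one, ← zpow_add₀ hp]
  push_cast
  ring_nf

/-- The basic operator depends on `ε` only through its last term. -/
theorem basicMatrix_eq_add (L : ℕ) (kp km ε p : ℂ) :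
    basicMatrix L kp km ε p =
      basicMatrix L kp km 0 p + ε • tensorOp fun _ : Fin L => qPowSigmaZ p := by
  simp [basicMatrix]

/-- One step of the construction: an eigenvector `f` of `w₀ + ε p^{σ_z}` for `ν`, and an
eigenvector of `ℬ_L` with the parameter `ν` in place of `ε`, give an eigenvector of `ℬ_{L+1}`. -/
theorem diagonalization_step {L : ℕ} {kp km ε p : ℂ} {ν : Fin 2 → ℂ}
    {P Q : Fin 2 → Matrix (Fin L → Fin 2) (Fin L → Fin 2) ℂ} {F G : Matrix (Fin 2) (Fin 2) ℂ}
    {d : Fin 2 → (Fin L → Fin 2) → ℂ} (hGF : G * F = 1)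
    (hF : (w0 kp km + ε • qPowSigmaZ p) * F = F * Matrix.diagonal ν)
    (hQP : ∀ a, Q a * P a = 1)
    (hP : ∀ a, basicMatrix L kp km (ν a) p * P a = P a * Matrix.diagonal (d a)) :
    let P' : Matrix (Fin (L + 1) → Fin 2) (Fin (L + 1) → Fin 2) ℂ := Matrix.of fun x s =>
      P (s (Fin.last L)) (Fin.init x) (Fin.init s) * F (x (Fin.last L)) (s (Fin.last L))
    let Q' : Matrix (Fin (L + 1) → Fin 2) (Fin (L + 1) → Fin 2) ℂ := Matrix.of fun s x =>
      Q (s (Fin.last L)) (Fin.init s) (Fin.init x) * G (s (Fin.last L)) (x (Fin.last L))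
    Q' * P' = 1 ∧ basicMatrix (L + 1) kp km ε p * P' =
      P' * Matrix.diagonal fun s => d (s (Fin.last L)) (Fin.init s) := by
  intro P' Q'
  constructor
  · ext s t
    induction s using Fin.snocCases with | _ s a =>
    induction t using Fin.snocCases with | _ t b =>
    have hfac : (Q' * P') (Fin.snoc s a) (Fin.snoc t b) = (Q a * P b) s t * (G * F) a b := by
      rw [Matrix.mul_apply, sum_snoc, Matrix.mul_apply, Matrix.mul_apply, Finset.sum_mul_sum]
      refine Finset.sum_congr rfl fun y _ => Finset.sum_congr rfl fun c _ => ?_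
      simp only [P', Q', Matrix.of_apply, Fin.init_snoc, Fin.snoc_last]
      ring
    rw [hfac, hGF]
    by_cases hab : a = b
    · subst hab
      simp [hQP, Matrix.one_apply]
    · simp [hab]
  · ext x t
    induction x using Fin.snocCases with | _ x a =>
    induction t using Fin.snocCases with | _ t b =>
    have hfac : (basicMatrix (L + 1) kp km ε p * P') (Fin.snoc x a) (Fin.snoc t b) =
        (basicMatrix L kp km 0 p * P b) x t * ((1 : Matrix (Fin 2) (Fin 2) ℂ) * F) a b +
        (tensorOp (fun _ : Fin L => qPowSigmaZ p) * P b) x t *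
          ((w0 kp km + ε • qPowSigmaZ p) * F) a b := by
      rw [Matrix.mul_apply, sum_snoc]
      simp only [Matrix.mul_apply (M := basicMatrix L kp km 0 p), Matrix.mul_apply (N := F),
        Matrix.mul_apply (M := tensorOp fun _ : Fin L => qPowSigmaZ p), Finset.sum_mul_sum,
        ← Finset.sum_add_distrib]
      refine Finset.sum_congr rfl fun y _ => Finset.sum_congr rfl fun c _ => ?_
      rw [basicMatrix_succ_snoc]
      simp only [P', Matrix.of_apply, Fin.init_snoc, Fin.snoc_last]
      ring
    have hPb := congrFun (congrFun (hP b) x) t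
    rw [basicMatrix_eq_add, Matrix.add_mul, Matrix.smul_mul, Matrix.add_apply, Matrix.smul_apply,
      Matrix.mul_diagonal, smul_eq_mul] at hPb
    rw [hfac, hF, Matrix.one_mul, Matrix.mul_diagonal, Matrix.mul_diagonal]
    simp only [P', Matrix.of_apply, Fin.init_snoc, Fin.snoc_last]
    linear_combination F a b * hPb

/-- If `a q₀ p(q₀)ᵐ ≠ a' q₀ p(q₀)⁻ᵐ` for all `m`, a basis of eigenvectors exists that depends
continuously on the parameters, at `q₀` included. -/
theorem exists_diagonalization (L : ℕ) {q₀ : ℂ} {kp km p : ℂ → ℂ}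
    (hkp : ContinuousAt kp q₀) (hkm : ContinuousAt km q₀) (hp : ContinuousAt p q₀)
    (hp0 : p q₀ ≠ 0) (hd : p q₀ - (p q₀)⁻¹ ≠ 0) (a a' : ℂ → ℂ)
    (ha : ContinuousAt a q₀) (ha' : ContinuousAt a' q₀)
    (hmul : ∀ᶠ q in 𝓝 q₀, a q * a' q * (p q - (p q)⁻¹) ^ 2 = -(kp q * km q))
    (hne : ∀ m : ℤ, a q₀ * p q₀ ^ m ≠ a' q₀ * p q₀ ^ (-m)) :
    ∃ P Q : ℂ → Matrix (Fin L → Fin 2) (Fin L → Fin 2) ℂ,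
      ContinuousAt P q₀ ∧ ContinuousAt Q q₀ ∧
      ∀ᶠ q in 𝓝 q₀, Q q * P q = 1 ∧
        basicMatrix L (kp q) (km q) (a q + a' q) (p q) * P q =
          P q * Matrix.diagonal fun s => theta L (a q) (a' q) (p q) (weight s) := by
  induction L generalizing a a' with
  | zero =>
    refine ⟨fun _ => 1, fun _ => 1, continuousAt_const, continuousAt_const,
      Eventually.of_forall fun q => ⟨one_mul 1, ?_⟩⟩
    ext x y
    simp [basicMatrix, tensorOp, Subsingleton.elim x y, theta, weight]
  | succ L ih =>
    have hpinv : ContinuousAt (fun q => (p q)⁻¹) q₀ := hp.inv₀ hp0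
    have hpne := hp.eventually_ne hp0
    obtain ⟨F, G, hF, hG, hFG⟩ := exists_diagonalization_site hkp hkm hp ha ha' hp0 hd hmul
      (by simpa using hne 0)
    obtain ⟨P₀, Q₀, hP₀, hQ₀, h₀⟩ := ih (fun q => a q * p q) (fun q => a' q * (p q)⁻¹)
      (ha.mul hp) (ha'.mul hpinv)
      (by filter_upwards [hmul, hpne] with q h hq
          rw [← h]; field_simp)
      (fun m => by
        have := hne (1 + m)
        rwa [neg_add, zpow_add₀ hp0, zpow_add₀ hp0, zpow_one, zpow_neg_one, ← mul_assoc,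
          ← mul_assoc] at this)
    obtain ⟨P₁, Q₁, hP₁, hQ₁, h₁⟩ := ih (fun q => a q * (p q)⁻¹) (fun q => a' q * p q)
      (ha.mul hpinv) (ha'.mul hp)
      (by filter_upwards [hmul, hpne] with q h hq
          rw [← h]; field_simp)
      (fun m => by
        have := hne (-1 + m)
        rwa [neg_add, neg_neg, zpow_add₀ hp0, zpow_add₀ hp0, zpow_one, zpow_neg_one, ← mul_assoc,
          ← mul_assoc] at this)
    refine ⟨fun q => Matrix.of fun x s =>
        (![P₀ q, P₁ q] (s (Fin.last L))) (Fin.init x) (Fin.init s) *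
          F q (x (Fin.last L)) (s (Fin.last L)),
      fun q => Matrix.of fun s x =>
        (![Q₀ q, Q₁ q] (s (Fin.last L))) (Fin.init s) (Fin.init x) *
          G q (s (Fin.last L)) (x (Fin.last L)), ?_, ?_, ?_⟩
    · refine continuousAt_pi.2 fun x => continuousAt_pi.2 fun s => ?_
      refine ContinuousAt.mul ?_ (continuousAt_pi.1 (continuousAt_pi.1 hF _) _)
      have hc : ∀ c, ContinuousAt (fun q => ![P₀ q, P₁ q] c) q₀ :=
        Fin.forall_fin_two.2 ⟨hP₀, hP₁⟩
      exact continuousAt_pi.1 (continuousAt_pi.1 (hc _) _) _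
    · refine continuousAt_pi.2 fun s => continuousAt_pi.2 fun x => ?_
      refine ContinuousAt.mul ?_ (continuousAt_pi.1 (continuousAt_pi.1 hG _) _)
      have hc : ∀ c, ContinuousAt (fun q => ![Q₀ q, Q₁ q] c) q₀ :=
        Fin.forall_fin_two.2 ⟨hQ₀, hQ₁⟩
      exact continuousAt_pi.1 (continuousAt_pi.1 (hc _) _) _
    · filter_upwards [hFG, h₀, h₁, hpne] with q hFG h₀ h₁ hq
      have hstep := diagonalization_step (P := ![P₀ q, P₁ q]) (Q := ![Q₀ q, Q₁ q])
        (d := ![fun s => theta L (a q * p q) (a' q * (p q)⁻¹) (p q) (weight s),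
          fun s => theta L (a q * (p q)⁻¹) (a' q * p q) (p q) (weight s)]) hFG.1 hFG.2
        (Fin.forall_fin_two.2 ⟨h₀.1, h₁.1⟩) (Fin.forall_fin_two.2 ⟨h₀.2, h₁.2⟩)
      refine ⟨hstep.1, hstep.2.trans ?_⟩
      congr 2
      ext s
      induction s using Fin.snocCases with | _ s b =>
      rw [weight_snoc, Fin.snoc_last, Fin.init_snoc]
      fin_cases b
      · exact theta_mul_inv L hq _
      · exact theta_inv_mul L hq _

theorem weight_le {L : ℕ} (s : Fin L → Fin 2) : weight s ≤ L :=
  (Finset.sum_le_card_nsmul _ _ 1 fun j _ => Nat.lt_succ_iff.1 (s j).2).trans (by simp)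

theorem ncard_weight_eq (L n : ℕ) : {s : Fin L → Fin 2 | weight s = n}.ncard = L.choose n := by
  have hw (s : Fin L → Fin 2) : weight s = (Finset.univ.filter fun j => s j = 1).card := by
    rw [Finset.card_filter]
    refine Finset.sum_congr rfl fun j _ => ?_
    rcases Fin.exists_fin_two.1 ⟨s j, rfl⟩ with h | h <;> simp [h]
  rw [Set.ncard_eq_toFinset_card', Set.toFinset_ofPred]
  conv_rhs => rw [← Finset.card_fin L, ← Finset.card_powersetCard]
  refine Finset.card_nbij' (fun s => Finset.univ.filter fun j => s j = 1)
    (fun A j => if j ∈ A then 1 else 0) ?_ ?_ ?_ ?_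
  · intro s hs
    simpa [Finset.mem_powersetCard, hw] using hs
  · intro A hA
    simpa [Finset.mem_powersetCard, hw] using hA
  · intro s _
    ext j
    rcases Fin.exists_fin_two.1 ⟨s j, rfl⟩ with h | h <;> simp [h]
  · intro A _
    ext j
    simp

theorem exists_weight_eq {L n : ℕ} (h : n ≤ L) : ∃ s : Fin L → Fin 2, weight s = n := by
  have hpos := Nat.choose_pos h
  rw [← ncard_weight_eq] at hpos
  exact Set.nonempty_of_ncard_ne_zero hpos.ne'

/-! ### The q-Dolan–Grady relation -/

section DolanGrady

/-- The `q`-deformed Dolan–Grady relation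
`B³D - [3] B²DB + [3] BDB² - DB³ = c (p + p⁻¹)² (BD - DB)`, where `[3] = p² + 1 + p⁻²`. -/
def DolanGrady {A : Type*} [Ring A] [Algebra ℂ A] (p c : ℂ) (B D : A) : Prop :=
  B * (B * (B * D)) - (p ^ 2 + 1 + p⁻¹ ^ 2) • (B * (B * (D * B)))
    + (p ^ 2 + 1 + p⁻¹ ^ 2) • (B * (D * (B * B))) - D * (B * (B * B))
  = (c * (p + p⁻¹) ^ 2) • (B * D - D * B)

/-- The relation passes from `B`, `D` to `w₀ ⊗ 𝕀 + p^{σ_z} ⊗ B` and `w₀ ⊗ 𝕀 + p^{-σ_z} ⊗ D`, written here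
as `2 × 2` block matrices. -/
theorem DolanGrady.block {A : Type*} [Ring A] [Algebra ℂ A] {p kp km : ℂ} (hp : p ≠ 0) {B D : A}
    (h : DolanGrady p (kp * km) B D) :
    DolanGrady p (kp * km) (!![p • B, kp • 1; km • 1, p⁻¹ • B] : Matrix (Fin 2) (Fin 2) A)
      !![p⁻¹ • D, kp • 1; km • 1, p • D] := by
  unfold DolanGrady at h ⊢
  rw [← sub_eq_zero] at h
  have hsmul (x : ℂ) := (congrArg (x • ·) h).trans (smul_zero x)
  ext i j
  rw [← sub_eq_zero]
  -- the diagonal entries are multiples of the given relation, up to terms that cancel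
  refine Eq.trans ?_ (hsmul (!![p ^ 2, 0; 0, p⁻¹ ^ 2] i j))
  fin_cases i <;> fin_cases j <;>
  · simp only [Matrix.mul_apply, Matrix.sub_apply, Matrix.add_apply, Matrix.smul_apply,
      Fin.sum_univ_two, Matrix.of_apply, Matrix.cons_val', Matrix.cons_val_zero,
      Matrix.cons_val_one, Fin.zero_eta, Fin.mk_one, Matrix.cons_val_fin_one,
      mul_add, smul_mul_assoc, mul_smul_comm, mul_one, one_mul, mul_assoc]
    match_scalars <;> field_simp <;> ring

theorem DolanGrady.map {A A' : Type*} [Ring A] [Algebra ℂ A] [Ring A'] [Algebra ℂ A'] {p c : ℂ}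
    {B D : A} (h : DolanGrady p c B D) (f : A ≃ₐ[ℂ] A') : DolanGrady p c (f B) (f D) := by
  have := congrArg f h
  simpa only [DolanGrady, map_sub, map_add, map_smul, map_mul] using this

/-- The first tensor factor split off: `ℬ_{L+1} = w₀ ⊗ 𝕀 + p^{σ_z} ⊗ ℬ_L`, as a `2 × 2` block
matrix. -/
theorem basicMatrix_succ_eq_block (L : ℕ) (kp km ε p : ℂ) :
    basicMatrix (L + 1) kp km ε p =
      ((Matrix.compAlgEquiv (Fin 2) (Fin L → Fin 2) ℂ ℂ).trans
        (Matrix.reindexAlgEquiv ℂ ℂ (Fin.consEquiv fun _ => Fin 2)))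
        !![p • basicMatrix L kp km ε p, kp • 1; km • 1, p⁻¹ • basicMatrix L kp km ε p] := by
  ext x y
  have hone : (∏ j : Fin L, (1 : Matrix (Fin 2) (Fin 2) ℂ) (x j.succ) (y j.succ)) =
      (1 : Matrix (Fin L → Fin 2) (Fin L → Fin 2) ℂ) (fun j => x j.succ) fun j => y j.succ := by
    simp only [Matrix.one_apply, Finset.prod_ite_zero, Finset.prod_const_one, funext_iff,
      Finset.mem_univ, true_imp_iff]
  have hsite (j : Fin L) : (∏ m : Fin (L + 1), (if m < j.succ then qPowSigmaZ p
      else if m = j.succ then w0 kp km else 1) (x m) (y m)) =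
      qPowSigmaZ p (x 0) (y 0) * ∏ m : Fin L, (if m < j then qPowSigmaZ p
      else if m = j then w0 kp km else 1) (x m.succ) (y m.succ) := by
    rw [Fin.prod_univ_succ]
    simp
  have hmain : basicMatrix (L + 1) kp km ε p x y =
      w0 kp km (x 0) (y 0) *
        (1 : Matrix (Fin L → Fin 2) (Fin L → Fin 2) ℂ) (fun j => x j.succ) (fun j => y j.succ) +
      qPowSigmaZ p (x 0) (y 0) *
        basicMatrix L kp km ε p (fun j => x j.succ) (fun j => y j.succ) := by
    simp only [basicMatrix, tensorOp, Matrix.add_apply, Matrix.sum_apply, Matrix.of_apply,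
      Matrix.smul_apply, smul_eq_mul, Fin.sum_univ_succ, hsite, ← Finset.mul_sum]
    rw [Fin.prod_univ_succ, Fin.prod_univ_succ]
    simp [Fin.succ_ne_zero, hone]
    ring
  rw [hmain]
  simp only [AlgEquiv.trans_apply, Matrix.coe_reindexAlgEquiv, Matrix.reindex_apply,
    Matrix.submatrix_apply, Matrix.compAlgEquiv_apply, Matrix.comp_apply, Fin.consEquiv]
  have h0 := Fin.exists_fin_two.1 ⟨x 0, rfl⟩
  have h1 := Fin.exists_fin_two.1 ⟨y 0, rfl⟩
  rcases h0 with h0 | h0 <;> rcases h1 with h1 | h1 <;>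
    simp [h0, h1, qPowSigmaZ, w0, sigmaPlus, sigmaMinus, Fin.tail_def]

theorem dolanGrady_basicMatrix (L : ℕ) {kp km ε ε' p : ℂ} (hp : p ≠ 0) :
    DolanGrady p (kp * km) (basicMatrix L kp km ε p) (basicMatrix L kp km ε' p⁻¹) := by
  induction L with
  | zero =>
    have h (e r : ℂ) : basicMatrix 0 kp km e r = e • 1 := by
      ext x y
      simp [basicMatrix, tensorOp, Subsingleton.elim x y]
    simp only [DolanGrady, h, smul_mul_assoc, mul_smul_comm, one_mul]
    module
  | succ L ih =>
    rw [basicMatrix_succ_eq_block, basicMatrix_succ_eq_block, inv_inv]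
    exact (ih.block hp).map _

/-- An eigenvector of `B` is mapped by `D` into the sum of three eigenspaces: on the component of
`D v` with eigenvalue `x`, the relation reads `(x - θ) (x - μ) (x - ν) = 0`. -/
theorem DolanGrady.map_eigenspace_le {X : Type*} [Fintype X] [DecidableEq X] {p c : ℂ}
    {B D P Q : Matrix X X ℂ} {d : X → ℂ} (h : DolanGrady p c B D) (hQP : Q * P = 1)
    (hB : B * P = P * Matrix.diagonal d) {θ μ ν : ℂ} (hadd : μ + ν = (p ^ 2 + p⁻¹ ^ 2) * θ)
    (hmul : μ * ν = θ ^ 2 - c * (p + p⁻¹) ^ 2) :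
    (Module.End.eigenspace (Matrix.toLin' B) θ).map (Matrix.toLin' D) ≤
      Module.End.eigenspace (Matrix.toLin' B) μ ⊔ Module.End.eigenspace (Matrix.toLin' B) θ ⊔
        Module.End.eigenspace (Matrix.toLin' B) ν := by
  rintro _ ⟨v, hv, rfl⟩
  have hv' : B.mulVec v = θ • v := by simpa using Module.End.mem_eigenspace_iff.1 hv
  have hcoord (u : X → ℂ) (s : X) : Q.mulVec (B.mulVec u) s = d s * Q.mulVec u s := by
    rw [Matrix.mulVec_mulVec, ← Matrix.mulVec_diagonal, Matrix.mulVec_mulVec,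
      mul_eq_diagonal_mul hQP hB]
  rw [eigenspace_eq_coordSubspace hQP hB, eigenspace_eq_coordSubspace hQP hB,
    eigenspace_eq_coordSubspace hQP hB, coordSubspace_sup hQP, coordSubspace_sup hQP]
  intro s hs
  simp only [Set.mem_union, Set.mem_ofPred_eq, not_or] at hs
  have hrel := congrFun (congrArg (fun M => Q.mulVec (M.mulVec v)) h) s
  simp only [Matrix.sub_mulVec, Matrix.add_mulVec, Matrix.smul_mulVec, ← Matrix.mulVec_mulVec, hv',
    Matrix.mulVec_smul, Matrix.mulVec_sub, Matrix.mulVec_add, Pi.sub_apply, Pi.add_apply,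
    Pi.smul_apply, smul_eq_mul, hcoord] at hrel
  have hfac : (d s - θ) * ((d s - μ) * (d s - ν)) * Q.mulVec (D.mulVec v) s = 0 := by
    linear_combination hrel + (d s - θ) * Q.mulVec (D.mulVec v) s * (hmul - d s * hadd)
  rw [Matrix.toLin'_apply]
  refine (mul_eq_zero.1 hfac).resolve_left ?_
  exact mul_ne_zero (sub_ne_zero.2 hs.1.2)
    (mul_ne_zero (sub_ne_zero.2 hs.1.1) (sub_ne_zero.2 hs.2))

end DolanGrady

/-! ### The eigenvalues `θ_n` -/

theorem theta_inv (L : ℕ) (a a' q : ℂ) (n : ℕ) : theta L a a' q⁻¹ n = theta L a' a q n := by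
  simp only [theta, inv_zpow', neg_add, neg_neg, sub_eq_add_neg]
  ring_nf

theorem theta_sub_theta (L : ℕ) {a a' q : ℂ} (hq : q ≠ 0) (m n : ℕ) :
    theta L a a' q m - theta L a a' q n =
      (q ^ ((n : ℤ) - m) - q ^ (-((n : ℤ) - m))) *
        (a * q ^ ((L : ℤ) - m - n) - a' * q ^ (-((L : ℤ) - m - n))) := by
  have h1 : (L : ℤ) - 2 * m = ((n : ℤ) - m) + ((L : ℤ) - m - n) := by ring
  have h2 : (L : ℤ) - 2 * n = -((n : ℤ) - m) + ((L : ℤ) - m - n) := by ring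
  have h3 : -(L : ℤ) + 2 * m = -((n : ℤ) - m) + -((L : ℤ) - m - n) := by ring
  have h4 : -(L : ℤ) + 2 * n = ((n : ℤ) - m) + -((L : ℤ) - m - n) := by ring
  simp only [theta]
  rw [h1, h2, h3, h4, zpow_add₀ hq, zpow_add₀ hq, zpow_add₀ hq, zpow_add₀ hq]
  ring

theorem theta_eq_theta_iff {L : ℕ} {a a' q : ℂ} (hq : q ≠ 0) {m n : ℕ}
    (hne : a * q ^ ((L : ℤ) - m - n) ≠ a' * q ^ (-((L : ℤ) - m - n))) :
    theta L a a' q m = theta L a a' q n ↔ (q ^ 2) ^ ((n : ℤ) - m) = 1 := by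
  rw [← sub_eq_zero, theta_sub_theta L hq, mul_eq_zero, or_iff_left (sub_ne_zero.2 hne),
    sub_eq_zero, zpow_neg, ← mul_eq_one_iff_eq_inv₀ (zpow_ne_zero _ hq), ← mul_zpow, ← sq]

theorem theta_add_nat (L : ℕ) (a a' : ℂ) {q : ℂ} (hq : q ≠ 0) (n k : ℕ) :
    theta L a a' q (n + k) = a * (q ^ ((L : ℤ) - 2 * n) * (q ^ (2 * k))⁻¹) +
      a' * ((q ^ ((L : ℤ) - 2 * n))⁻¹ * q ^ (2 * k)) := by
  have h1 : (L : ℤ) - 2 * ((n + k : ℕ) : ℤ) = (L - 2 * n) + -((2 * k : ℕ) : ℤ) := by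
    push_cast; ring
  have h2 : -(L : ℤ) + 2 * ((n + k : ℕ) : ℤ) = -(L - 2 * n) + ((2 * k : ℕ) : ℤ) := by
    push_cast; ring
  rw [theta, h1, h2, zpow_add₀ hq, zpow_add₀ hq, zpow_neg, zpow_neg, zpow_natCast]

theorem theta_add_theta (L : ℕ) (a a' : ℂ) {q : ℂ} (hq : q ≠ 0) (n : ℕ) :
    theta L a a' q (n + 2) + theta L a a' q n = (q ^ 2 + q⁻¹ ^ 2) * theta L a a' q (n + 1) := by
  have h0 := theta_add_nat L a a' hq n 0
  rw [add_zero] at h0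
  rw [theta_add_nat L a a' hq, theta_add_nat L a a' hq, h0]
  have hz := zpow_ne_zero ((L : ℤ) - 2 * n) hq
  generalize q ^ ((L : ℤ) - 2 * n) = z at hz
  field_simp
  ring

theorem theta_mul_theta (L : ℕ) (a a' : ℂ) {q : ℂ} (hq : q ≠ 0) (n : ℕ) :
    theta L a a' q (n + 2) * theta L a a' q n =
      theta L a a' q (n + 1) ^ 2 + a * a' * (q - q⁻¹) ^ 2 * (q + q⁻¹) ^ 2 := by
  have h0 := theta_add_nat L a a' hq n 0
  rw [add_zero] at h0
  rw [theta_add_nat L a a' hq, theta_add_nat L a a' hq, h0]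
  have hz := zpow_ne_zero ((L : ℤ) - 2 * n) hq
  generalize q ^ ((L : ℤ) - 2 * n) = z at hz
  field_simp
  ring

/-- Away from `q₀`, two different `θ_m`, `θ_n` are different: near `q₀` they could only agree at a
root of unity of bounded order. -/
theorem eventually_theta_ne {L : ℕ} {q₀ : ℂ} {a a' : ℂ → ℂ} (hq₀ : q₀ ≠ 0)
    (ha : ContinuousAt a q₀) (ha' : ContinuousAt a' q₀)
    (hne : ∀ m : ℤ, a q₀ * q₀ ^ m ≠ a' q₀ * q₀ ^ (-m)) {m n : ℕ} (hmn : m ≠ n) :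
    ∀ᶠ q in 𝓝[≠] q₀, theta L (a q) (a' q) q m ≠ theta L (a q) (a' q) q n := by
  have hk : 0 < 2 * ((n : ℤ) - m).natAbs := by omega
  have hfin : {q : ℂ | q ^ (2 * ((n : ℤ) - m).natAbs) = 1}.Finite := by
    refine (Polynomial.nthRootsFinset (2 * ((n : ℤ) - m).natAbs) (1 : ℂ)).finite_toSet.subset ?_
    intro q hq
    exact (Polynomial.mem_nthRootsFinset hk 1).2 hq
  have hpow (k : ℤ) : ContinuousAt (fun q : ℂ => q ^ k) q₀ := continuousAt_zpow₀ q₀ k (Or.inl hq₀)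
  have hne' : ∀ᶠ q in 𝓝 q₀, a q * q ^ ((L : ℤ) - m - n) ≠ a' q * q ^ (-((L : ℤ) - m - n)) :=
    ((ha.mul (hpow _)).tendsto.prodMk_nhds (ha'.mul (hpow _)).tendsto).eventually
      (isOpen_ne_fun continuous_fst continuous_snd |>.mem_nhds (hne _))
  filter_upwards [hne'.filter_mono nhdsWithin_le_nhds,
    (eventually_ne_nhds hq₀).filter_mono nhdsWithin_le_nhds,
    nhdsNE_le_cofinite q₀ hfin.compl_mem_cofinite] with q h1 h2 h3
  rw [Ne, theta_eq_theta_iff h2 h1]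
  intro h
  refine h3 ?_
  change q ^ (2 * ((n : ℤ) - m).natAbs) = 1
  rw [pow_mul]
  rcases Int.natAbs_eq ((n : ℤ) - m) with h' | h'
  · rwa [h', zpow_natCast] at h
  · rwa [h', zpow_neg, inv_eq_one, zpow_natCast] at h

/-! ### The root of unity `q₀` and the coefficients `a₂`, `a₃` -/

section RootOfUnity

variable {N : ℕ} {q₀ : ℂ}

theorem isPrimitiveRoot_sq (hN : N ≠ 0)
    (hq₀ : q₀ = Complex.exp (Complex.I * (Real.pi : ℂ) / (N : ℂ))) :
    IsPrimitiveRoot (q₀ ^ 2) N := by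
  have h := Complex.isPrimitiveRoot_exp N hN
  rw [hq₀, ← Complex.exp_nat_mul]
  convert h using 2
  push_cast
  ring

theorem zpow_add_zpow_neg (hq₀ : q₀ = Complex.exp (Complex.I * (Real.pi : ℂ) / (N : ℂ))) (m : ℤ) :
    q₀ ^ m + q₀ ^ (-m) = 2 * Complex.cos ((m : ℂ) * (Real.pi : ℂ) / (N : ℂ)) := by
  rw [Complex.two_cos, hq₀, ← Complex.exp_int_mul, ← Complex.exp_int_mul]
  push_cast
  ring_nf

theorem sq_sub_inv (hq₀ : q₀ = Complex.exp (Complex.I * (Real.pi : ℂ) / (N : ℂ))) :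
    (q₀ - q₀⁻¹) ^ 2 = -4 * Complex.sin ((Real.pi : ℂ) / (N : ℂ)) ^ 2 := by
  have h : 2 * Complex.sin ((Real.pi : ℂ) / (N : ℂ)) = (q₀⁻¹ - q₀) * Complex.I := by
    rw [Complex.two_sin, hq₀, ← Complex.exp_neg]
    ring_nf
  linear_combination (2 * Complex.sin ((Real.pi : ℂ) / (N : ℂ)) + (q₀⁻¹ - q₀) * Complex.I) * h +
    (q₀⁻¹ - q₀) ^ 2 * Complex.I_sq

theorem sub_inv_ne_zero (hN : 2 < N)
    (hq₀ : q₀ = Complex.exp (Complex.I * (Real.pi : ℂ) / (N : ℂ))) : q₀ - q₀⁻¹ ≠ 0 := by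
  have hq : q₀ ≠ 0 := hq₀ ▸ Complex.exp_ne_zero _
  intro h
  have h1 : q₀ ^ 2 = 1 := by
    rw [sq]
    nth_rewrite 2 [sub_eq_zero.1 h]
    exact mul_inv_cancel₀ hq
  exact (isPrimitiveRoot_sq (by omega) hq₀).ne_one (by omega) h1

theorem eventually_sub_inv_ne_zero (hq : q₀ ≠ 0) (hd : q₀ - q₀⁻¹ ≠ 0) :
    ∀ᶠ q in 𝓝 q₀, q - q⁻¹ ≠ 0 :=
  (continuousAt_id.sub (continuousAt_inv₀ hq)).eventually_ne hd

variable {kp km ε a₂ a₃ : ℂ → ℂ}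

theorem IsCoeffPair.mul_sq_eq (h : IsCoeffPair q₀ kp km ε a₂ a₃) (hq : q₀ ≠ 0)
    (hd : q₀ - q₀⁻¹ ≠ 0) :
    ∀ᶠ q in 𝓝 q₀, a₂ q * a₃ q * (q - q⁻¹) ^ 2 = -(kp q * km q) := by
  filter_upwards [h.mul_eq, eventually_sub_inv_ne_zero hq hd] with q h1 h2
  rw [h1, div_mul_cancel₀ _ (pow_ne_zero 2 h2)]

/-- The genericity of the parameters in terms of `a₂`, `a₃`:
`(a₂ + a₃)² - a₂ a₃ (z + z⁻¹)² = (a₂ - a₃ z²) (a₂ - a₃ z⁻²)` with `z = q₀ᵐ`. -/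
theorem IsCoeffPair.mul_zpow_ne (h : IsCoeffPair q₀ kp km ε a₂ a₃) (hN : 2 < N)
    (hq₀ : q₀ = Complex.exp (Complex.I * (Real.pi : ℂ) / (N : ℂ)))
    (hgen : ∀ m : ℤ, (ε q₀) ^ 2 * Complex.sin ((Real.pi : ℂ) / (N : ℂ)) ^ 2 ≠
      kp q₀ * km q₀ * Complex.cos ((m : ℂ) * (Real.pi : ℂ) / (N : ℂ)) ^ 2) (m : ℤ) :
    a₂ q₀ * q₀ ^ m ≠ a₃ q₀ * q₀ ^ (-m) := by
  have hq : q₀ ≠ 0 := hq₀ ▸ Complex.exp_ne_zero _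
  intro heq
  refine hgen m ?_
  have hmul := (h.mul_sq_eq hq (sub_inv_ne_zero hN hq₀)).self_of_nhds
  have hcos := zpow_add_zpow_neg hq₀ m
  rw [sq_sub_inv hq₀] at hmul
  rw [zpow_neg] at heq hcos
  have hz := zpow_ne_zero m hq
  have h3 : a₃ q₀ = a₂ q₀ * (q₀ ^ m) ^ 2 := by
    field_simp at heq
    exact heq.symm
  have hc : Complex.cos ((m : ℂ) * (Real.pi : ℂ) / (N : ℂ)) = (q₀ ^ m + (q₀ ^ m)⁻¹) / 2 := by
    rw [hcos]; ring
  have hk : kp q₀ * km q₀ =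
      4 * (a₂ q₀ * a₃ q₀) * Complex.sin ((Real.pi : ℂ) / (N : ℂ)) ^ 2 := by
    linear_combination hmul
  rw [← h.add_eq.self_of_nhds, hc, hk, h3]
  field_simp
  ring

theorem exists_isCoeffPair (hkp : ContinuousAt kp q₀) (hkm : ContinuousAt km q₀)
    (hε : ContinuousAt ε q₀) (hq : q₀ ≠ 0) (hd : q₀ - q₀⁻¹ ≠ 0)
    (hdisc : ε q₀ ^ 2 + 4 * (kp q₀ * km q₀) / (q₀ - q₀⁻¹) ^ 2 ≠ 0) :
    ∃ a₂ a₃ : ℂ → ℂ, IsCoeffPair q₀ kp km ε a₂ a₃ := by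
  set Δ : ℂ → ℂ := fun q => ε q ^ 2 + 4 * (kp q * km q) / (q - q⁻¹) ^ 2 with hΔ
  have hΔc : ContinuousAt Δ q₀ :=
    (hε.pow 2).add ((continuousAt_const.mul (hkp.mul hkm)).div
      ((continuousAt_id.sub (continuousAt_inv₀ hq)).pow 2) (pow_ne_zero 2 hd))
  -- a square root of the discriminant, continuous at `q₀` since `Δ q₀ / Δ q₀ = 1` is off the cut
  obtain ⟨r₀, hr₀⟩ := IsAlgClosed.exists_pow_nat_eq (Δ q₀) two_pos
  have hrc : ContinuousAt (fun q => r₀ * (Δ q / Δ q₀) ^ ((2 : ℂ)⁻¹)) q₀ := by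
    refine continuousAt_const.mul ((hΔc.div_const _).cpow continuousAt_const ?_)
    rw [div_self hdisc]
    exact Complex.one_mem_slitPlane
  set r : ℂ → ℂ := fun q => r₀ * (Δ q / Δ q₀) ^ ((2 : ℂ)⁻¹) with hr
  have hsq (q : ℂ) : r q ^ 2 = Δ q := by
    have h2 := Complex.cpow_ofNat_inv_pow (Δ q / Δ q₀) 2
    rw [hr, mul_pow, hr₀, h2, mul_div_cancel₀ _ hdisc]
  refine ⟨fun q => (ε q + r q) / 2, fun q => (ε q - r q) / 2, (hε.add hrc).div_const 2,
    (hε.sub hrc).div_const 2, Eventually.of_forall fun q => by ring,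
    Eventually.of_forall fun q => ?_⟩
  have h := hsq q
  simp only [hΔ] at h
  linear_combination -h / 4

theorem isCoeffPair_exp (hq : q₀ ≠ 0) (hd : q₀ - q₀⁻¹ ≠ 0) {α η : ℂ}
    (h : ∀ᶠ q in 𝓝 q₀, ε q = Complex.cosh α ∧
        kp q = -(q - q⁻¹) * Complex.exp (Complex.I * η) / 2 ∧
        km q = (q - q⁻¹) * Complex.exp (-(Complex.I * η)) / 2) :
    IsCoeffPair q₀ kp km ε (fun _ => Complex.exp α / 2) fun _ => Complex.exp (-α) / 2 := by
  refine ⟨continuousAt_const, continuousAt_const, ?_, ?_⟩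
  · filter_upwards [h] with q hq
    rw [hq.1, Complex.cosh]
    ring
  · filter_upwards [h, eventually_sub_inv_ne_zero hq hd] with q hq hdq
    rw [hq.2.1, hq.2.2, eq_div_iff (pow_ne_zero 2 hdq), Complex.exp_neg, Complex.exp_neg]
    have h1 := Complex.exp_ne_zero α
    have h2 := Complex.exp_ne_zero (Complex.I * η)
    generalize q - q⁻¹ = d
    field_simp

theorem isCoeffPair_zero (hε : ContinuousAt ε q₀) (h : ∀ᶠ q in 𝓝 q₀, km q = 0) :
    IsCoeffPair q₀ kp km ε ε fun _ => 0 :=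
  ⟨hε, continuousAt_const, Eventually.of_forall fun q => add_zero _, by
    filter_upwards [h] with q hq
    simp [hq]⟩

end RootOfUnity

/-! ### Diagonalization of `𝒲ᵢ` and its consequences -/

section Spectrum

variable {L N : ℕ} {q₀ : ℂ} {i : Fin 2} {kp km ε a₂ a₃ : ℂ → ℂ}

/-- A basis of eigenvectors of `𝒲ᵢ`, the columns of `P q`, that depends continuously on `q` at `q₀`.
The case of `q⁻¹` differs by the exchange of `a₂` and `a₃`. -/
theorem IsCoeffPair.exists_diagonalization (h : IsCoeffPair q₀ kp km ε a₂ a₃)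
    (hkp : ContinuousAt kp q₀) (hkm : ContinuousAt km q₀) (hq : q₀ ≠ 0) (hd : q₀ - q₀⁻¹ ≠ 0)
    (hne : ∀ m : ℤ, a₂ q₀ * q₀ ^ m ≠ a₃ q₀ * q₀ ^ (-m)) (L : ℕ) (i : Fin 2) :
    ∃ P Q : ℂ → Matrix (Fin L → Fin 2) (Fin L → Fin 2) ℂ,
      ContinuousAt P q₀ ∧ ContinuousAt Q q₀ ∧
      ∀ᶠ q in 𝓝 q₀, Q q * P q = 1 ∧
        basicMatrix L (kp q) (km q) (ε q) (if i = 0 then q else q⁻¹) * P q =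
          P q * Matrix.diagonal fun s => theta L (a₂ q) (a₃ q) q (weight s) := by
  have hmul := h.mul_sq_eq hq hd
  by_cases hi : i = 0
  · obtain ⟨P, Q, hP, hQ, hPQ⟩ := XXZ.exists_diagonalization L hkp hkm continuousAt_id hq hd a₂ a₃
      h.continuousAt_left h.continuousAt_right hmul hne
    refine ⟨P, Q, hP, hQ, ?_⟩
    filter_upwards [hPQ, h.add_eq] with q h1 h2
    simpa only [hi, if_true, ← h2, id_eq] using h1
  · obtain ⟨P, Q, hP, hQ, hPQ⟩ := XXZ.exists_diagonalization L hkp hkm (continuousAt_inv₀ hq)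
      (inv_ne_zero hq) (by rwa [inv_inv, ← neg_sub, neg_ne_zero]) a₃ a₂
      h.continuousAt_right h.continuousAt_left
      (by filter_upwards [hmul] with q h1
          rw [inv_inv, ← h1]; ring)
      (fun m => by simpa only [inv_zpow', neg_neg] using (hne m).symm)
    refine ⟨P, Q, hP, hQ, ?_⟩
    filter_upwards [hPQ, h.add_eq] with q h1 h2
    simpa only [hi, if_false, ← h2, add_comm (a₂ q), theta_inv] using h1

theorem eventually_forall_theta_ne (hq : q₀ ≠ 0) (ha : ContinuousAt a₂ q₀)
    (ha' : ContinuousAt a₃ q₀) (hne : ∀ m : ℤ, a₂ q₀ * q₀ ^ m ≠ a₃ q₀ * q₀ ^ (-m)) (n : ℕ) :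
    ∀ᶠ q in 𝓝[≠] q₀, ∀ m ≤ L, m ≠ n → theta L (a₂ q) (a₃ q) q m ≠ theta L (a₂ q) (a₃ q) q n := by
  have h : ∀ᶠ q in 𝓝[≠] q₀, ∀ m ∈ Set.Iic L, m ≠ n →
      theta L (a₂ q) (a₃ q) q m ≠ theta L (a₂ q) (a₃ q) q n := by
    rw [eventually_all_finite (Set.finite_Iic L)]
    exact fun m _ => eventually_imp_distrib_left.2 fun hmn => eventually_theta_ne hq ha ha' hne hmn
  exact h

/-- For generic `q`, the eigenspace for `θ_n` is spanned by the basis vectors of weight `n`. -/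
theorem eventually_genericEigenspace_eq (hq : q₀ ≠ 0) (ha : ContinuousAt a₂ q₀)
    (ha' : ContinuousAt a₃ q₀) (hne : ∀ m : ℤ, a₂ q₀ * q₀ ^ m ≠ a₃ q₀ * q₀ ^ (-m))
    {P Q : ℂ → Matrix (Fin L → Fin 2) (Fin L → Fin 2) ℂ}
    (hPQ : ∀ᶠ q in 𝓝 q₀, Q q * P q = 1 ∧
        basicMatrix L (kp q) (km q) (ε q) (if i = 0 then q else q⁻¹) * P q =
          P q * Matrix.diagonal fun s => theta L (a₂ q) (a₃ q) q (weight s)) (n : ℕ) :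
    ∀ᶠ q in 𝓝[≠] q₀, genericEigenspace L i kp km ε a₂ a₃ n q =
      coordSubspace (Q q) {s | weight s = n} := by
  filter_upwards [hPQ.filter_mono nhdsWithin_le_nhds,
    eventually_forall_theta_ne (L := L) hq ha ha' hne n] with q h1 h2
  rw [genericEigenspace, W, eigenspace_eq_coordSubspace h1.1 h1.2]
  congr 1
  ext s
  exact ⟨fun h => not_not.1 fun hn => h2 _ (weight_le s) hn h, fun h => congrArg _ h⟩

theorem theta_eq_theta_iff_modEq (hroot : IsPrimitiveRoot (q₀ ^ 2) N) (hq : q₀ ≠ 0) {a a' : ℂ}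
    (hne : ∀ m : ℤ, a * q₀ ^ m ≠ a' * q₀ ^ (-m)) {m n : ℕ} :
    theta L a a' q₀ m = theta L a a' q₀ n ↔ m ≡ n [MOD N] := by
  rw [theta_eq_theta_iff hq (hne _), hroot.zpow_eq_one_iff_dvd, Nat.modEq_iff_dvd]

/-- At `q₀`, the operator `𝒲_{1-i}` acts on the eigenspaces of `𝒲ᵢ` in a tridiagonal way. -/
theorem map_VN_le (hq : q₀ ≠ 0) (h : IsCoeffPair q₀ kp km ε a₂ a₃) (hd : q₀ - q₀⁻¹ ≠ 0)
    {P Q : Matrix (Fin L → Fin 2) (Fin L → Fin 2) ℂ} (hQP : Q * P = 1)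
    (hP : basicMatrix L (kp q₀) (km q₀) (ε q₀) (if i = 0 then q₀ else q₀⁻¹) * P =
      P * Matrix.diagonal fun s => theta L (a₂ q₀) (a₃ q₀) q₀ (weight s)) (ε' : ℂ) (n : ℕ) :
    (VN L i q₀ kp km ε a₂ a₃ (n + 1)).map (W L (1 - i) (kp q₀) (km q₀) ε' q₀) ≤
      VN L i q₀ kp km ε a₂ a₃ (n + 2) ⊔ VN L i q₀ kp km ε a₂ a₃ (n + 1) ⊔
        VN L i q₀ kp km ε a₂ a₃ n := by
  have hmul := (h.mul_sq_eq hq hd).self_of_nhds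
  have hadd := theta_add_theta L (a₂ q₀) (a₃ q₀) hq n
  have hprod := theta_mul_theta L (a₂ q₀) (a₃ q₀) hq n
  rw [hmul] at hprod
  have hi := Fin.exists_fin_two.1 ⟨i, rfl⟩
  rcases hi with rfl | rfl
  · exact (dolanGrady_basicMatrix L hq).map_eigenspace_le hQP hP hadd (by rw [hprod]; ring)
  · have hDG := dolanGrady_basicMatrix L (kp := kp q₀) (km := km q₀) (ε := ε q₀) (ε' := ε')
      (inv_ne_zero hq)
    rw [inv_inv] at hDG
    exact hDG.map_eigenspace_le hQP hP (by rw [hadd, inv_inv]; ring) (by rw [hprod, inv_inv]; ring)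

end Spectrum

end XXZ

theorem mainTheorem7 (L N : ℕ) (hN : 2 < N) (q₀ : ℂ)
    (hq₀ : q₀ = Complex.exp (Complex.I * (Real.pi : ℂ) / (N : ℂ)))
    (kp km : ℂ → ℂ) (ε : Fin 2 → ℂ → ℂ)
    (hkp : ContinuousAt kp q₀) (hkm : ContinuousAt km q₀)
    (i : Fin 2) (hε : ContinuousAt (ε i) q₀)
    (hgen : ∀ m : ℤ, (ε i q₀) ^ 2 * Complex.sin ((Real.pi : ℂ) / (N : ℂ)) ^ 2 ≠
      kp q₀ * km q₀ * Complex.cos ((m : ℂ) * (Real.pi : ℂ) / (N : ℂ)) ^ 2) :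
    -- the coefficient functions exist, and their values in the two special cases
    (∃ a₂ a₃ : ℂ → ℂ, XXZ.IsCoeffPair q₀ kp km (ε i) a₂ a₃) ∧
    (∀ α η : ℂ,
      (∀ᶠ q in 𝓝 q₀, ε i q = Complex.cosh α ∧
        kp q = -(q - q⁻¹) * Complex.exp (Complex.I * η) / 2 ∧
        km q = (q - q⁻¹) * Complex.exp (-(Complex.I * η)) / 2) →
      XXZ.IsCoeffPair q₀ kp km (ε i)
        (fun _ => Complex.exp α / 2) (fun _ => Complex.exp (-α) / 2)) ∧
    ((∀ᶠ q in 𝓝 q₀, km q = 0) → XXZ.IsCoeffPair q₀ kp km (ε i) (ε i) (fun _ => 0)) ∧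
    ∀ a₂ a₃ : ℂ → ℂ, XXZ.IsCoeffPair q₀ kp km (ε i) a₂ a₃ →
      -- generic `q` near `q₀`: distinct eigenvalues, dimensions of the eigenspaces
      (∀ᶠ q in 𝓝[≠] q₀,
        Set.InjOn (XXZ.theta L (a₂ q) (a₃ q) q) (Set.Iic L) ∧
        ∀ n ≤ L, Module.finrank ℂ
          (XXZ.genericEigenspace L i kp km (ε i) a₂ a₃ n q) = L.choose n) ∧
      -- the spaces `V_n` at `q₀` are genuine limits, and `V_n = 0` for `n > L`
      (∀ n : ℕ, Module.finrank ℂ (XXZ.V L i q₀ kp km (ε i) a₂ a₃ n) = L.choose n) ∧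
      -- the spectrum at `q₀`
      Set.InjOn (XXZ.theta L (a₂ q₀) (a₃ q₀) q₀) (Set.Iio N) ∧
      (N ≤ L + 1 →
        {x : ℂ | Module.End.HasEigenvalue
            (XXZ.W L i (kp q₀) (km q₀) (ε i q₀) q₀) x} =
          XXZ.theta L (a₂ q₀) (a₃ q₀) q₀ '' Set.Iio N ∧
        {x : ℂ | Module.End.HasEigenvalue
            (XXZ.W L i (kp q₀) (km q₀) (ε i q₀) q₀) x}.ncard = N) ∧
      (⨆ t : Fin N, XXZ.VN L i q₀ kp km (ε i) a₂ a₃ t) = ⊤ ∧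
      -- the eigenspaces at `q₀`
      (∀ t < N,
        iSupIndep (fun k : Fin (L / N + 1) =>
          XXZ.V L i q₀ kp km (ε i) a₂ a₃ (t + k * N)) ∧
        XXZ.VN L i q₀ kp km (ε i) a₂ a₃ t =
          ⨆ k : Fin (L / N + 1), XXZ.V L i q₀ kp km (ε i) a₂ a₃ (t + k * N)) ∧
      -- the cyclic tridiagonal action
      (∀ t < N,
        (XXZ.VN L i q₀ kp km (ε i) a₂ a₃ t).map
            (XXZ.W L i (kp q₀) (km q₀) (ε i q₀) q₀) ≤
          XXZ.VN L i q₀ kp km (ε i) a₂ a₃ t ∧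
        (XXZ.VN L i q₀ kp km (ε i) a₂ a₃ t).map
            (XXZ.W L (1 - i) (kp q₀) (km q₀) (ε (1 - i) q₀) q₀) ≤
          XXZ.VN L i q₀ kp km (ε i) a₂ a₃ ((t + 1) % N) ⊔
          XXZ.VN L i q₀ kp km (ε i) a₂ a₃ t ⊔
          XXZ.VN L i q₀ kp km (ε i) a₂ a₃ ((t + N - 1) % N)) := by
  have hq : q₀ ≠ 0 := hq₀ ▸ Complex.exp_ne_zero _
  have hd := XXZ.sub_inv_ne_zero hN hq₀
  have hroot := XXZ.isPrimitiveRoot_sq (by omega) hq₀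
  have hsq := XXZ.sq_sub_inv hq₀
  refine ⟨XXZ.exists_isCoeffPair hkp hkm hε hq hd ?_, fun α η h => XXZ.isCoeffPair_exp hq hd h,
    XXZ.isCoeffPair_zero hε, fun a₂ a₃ h => ?_⟩
  · have h0 := hgen 0
    have hs : Complex.sin ((Real.pi : ℂ) / (N : ℂ)) ≠ 0 := by
      intro hs
      rw [hs] at hsq
      exact pow_ne_zero 2 hd (by rw [hsq]; ring)
    contrapose! h0
    rw [hsq] at h0
    field_simp at h0
    simp only [Int.cast_zero, zero_mul, zero_div, Complex.cos_zero]
    linear_combination h0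
  have hne := h.mul_zpow_ne hN hq₀ hgen
  have ha := h.continuousAt_left
  have ha' := h.continuousAt_right
  obtain ⟨P, Q, hP, hQ, hPQ⟩ := h.exists_diagonalization hkp hkm hq hd hne L i
  obtain ⟨hQP₀, hM₀⟩ := hPQ.self_of_nhds
  have hθ {m n : ℕ} : XXZ.theta L (a₂ q₀) (a₃ q₀) q₀ m = XXZ.theta L (a₂ q₀) (a₃ q₀) q₀ n ↔
      m ≡ n [MOD N] := XXZ.theta_eq_theta_iff_modEq hroot hq hne
  have hgenE := XXZ.eventually_genericEigenspace_eq hq ha ha' hne hPQ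
  have hV (n : ℕ) : XXZ.V L i q₀ kp km (ε i) a₂ a₃ n =
      XXZ.coordSubspace (Q q₀) {s | XXZ.weight s = n} :=
    XXZ.subspaceLimit_eq_coordSubspace (hP.tendsto.mono_left nhdsWithin_le_nhds)
      (hQ.tendsto.mono_left nhdsWithin_le_nhds) hQP₀
      ((hPQ.mono fun _ h => h.1).filter_mono nhdsWithin_le_nhds) (hgenE n)
  have hVN (t : ℕ) : XXZ.VN L i q₀ kp km (ε i) a₂ a₃ t =
      XXZ.coordSubspace (Q q₀) {s | XXZ.weight s ≡ t [MOD N]} := by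
    rw [XXZ.VN, XXZ.W, XXZ.eigenspace_eq_coordSubspace hQP₀ hM₀]
    simp only [hθ]
  have hinj : Set.InjOn (XXZ.theta L (a₂ q₀) (a₃ q₀) q₀) (Set.Iio N) :=
    fun m hm n hn hmn => Nat.ModEq.eq_of_lt_of_lt (hθ.1 hmn) hm hn
  have hspec (x : ℂ) : Module.End.HasEigenvalue
      (XXZ.W L i (kp q₀) (km q₀) (ε i q₀) q₀) x ↔
        ∃ s : Fin L → Fin 2, XXZ.theta L (a₂ q₀) (a₃ q₀) q₀ (XXZ.weight s) = x :=
    XXZ.hasEigenvalue_toLin'_iff hQP₀ hM₀ x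
  refine ⟨?_, fun n => ?_, hinj, fun hNL => ?_, ?_, fun t ht => ⟨?_, ?_⟩, fun t ht => ⟨?_, ?_⟩⟩
  · have hdist : ∀ᶠ q in 𝓝[≠] q₀, ∀ n ∈ Set.Iic L, ∀ m ≤ L, m ≠ n →
        XXZ.theta L (a₂ q) (a₃ q) q m ≠ XXZ.theta L (a₂ q) (a₃ q) q n :=
      (eventually_all_finite (Set.finite_Iic L)).2 fun n _ =>
        XXZ.eventually_forall_theta_ne hq ha ha' hne n
    have hE := (eventually_all_finite (Set.finite_Iic L)).2 fun n _ => hgenE n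
    filter_upwards [hdist, hE, hPQ.filter_mono nhdsWithin_le_nhds] with q h1 h2 h3
    refine ⟨fun m hm n hn hmn => not_not.1 fun hne => h1 n hn m hm hne hmn, fun n hn => ?_⟩
    rw [h2 n hn, XXZ.finrank_coordSubspace h3.1, XXZ.ncard_weight_eq]
  · rw [hV, XXZ.finrank_coordSubspace hQP₀, XXZ.ncard_weight_eq]
  · have hset : {x : ℂ | Module.End.HasEigenvalue
        (XXZ.W L i (kp q₀) (km q₀) (ε i q₀) q₀) x} =
          XXZ.theta L (a₂ q₀) (a₃ q₀) q₀ '' Set.Iio N := by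
      ext x
      rw [Set.mem_ofPred_eq, hspec, Set.mem_image]
      constructor
      · rintro ⟨s, rfl⟩
        exact ⟨XXZ.weight s % N, Nat.mod_lt _ (by omega), hθ.2 (Nat.mod_modEq _ _)⟩
      · rintro ⟨t, ht, rfl⟩
        obtain ⟨s, hs⟩ := XXZ.exists_weight_eq (L := L) (n := t) (by
          have : t < N := ht
          omega)
        exact ⟨s, by rw [hs]⟩
    refine ⟨hset, ?_⟩
    rw [hset, hinj.ncard_image, ← Finset.coe_Iio, Set.ncard_coe_finset, Nat.card_Iio]
  · simp only [hVN]
    rw [XXZ.coordSubspace_iUnion hQP₀, eq_top_iff]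
    intro v _ s hs
    refine absurd (Set.mem_iUnion.2 ⟨⟨XXZ.weight s % N, Nat.mod_lt _ (by omega)⟩, ?_⟩) hs
    exact (Nat.mod_modEq _ _).symm
  · simp only [hV]
    refine XXZ.iSupIndep_coordSubspace hQP₀ _ fun j k hjk => Set.disjoint_left.2 fun s hj hk => ?_
    have hjk' : t + (j : ℕ) * N = t + k * N := hj.symm.trans hk
    exact hjk (Fin.ext (Nat.eq_of_mul_eq_mul_right (by omega) (Nat.add_left_cancel hjk')))
  · simp only [hV, hVN]
    rw [XXZ.coordSubspace_iUnion hQP₀]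
    congr 1
    ext s
    rw [Set.mem_iUnion]
    constructor
    · intro hs
      have hmod : XXZ.weight s % N = t := (show _ % N = t % N from hs).trans (Nat.mod_eq_of_lt ht)
      refine ⟨⟨XXZ.weight s / N, Nat.lt_succ_of_le (Nat.div_le_div_right (XXZ.weight_le s))⟩, ?_⟩
      change XXZ.weight s = t + XXZ.weight s / N * N
      rw [← hmod, mul_comm, Nat.mod_add_div]
    · rintro ⟨k, hk⟩
      have hk' : XXZ.weight s = t + k * N := hk
      change XXZ.weight s % N = t % N
      rw [hk', Nat.add_mul_mod_self_right]
  · rintro _ ⟨v, hv, rfl⟩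
    rw [Module.End.mem_eigenspace_iff.1 hv]
    exact Submodule.smul_mem _ _ hv
  · -- the three indices are shifted by `N`, so that `t - 1` does not leave `ℕ`
    have hmap := XXZ.map_VN_le hq h hd hQP₀ hM₀ (ε (1 - i) q₀) (t + N - 1)
    have hper {m n : ℕ} (hmn : m ≡ n [MOD N]) :
        XXZ.VN L i q₀ kp km (ε i) a₂ a₃ m = XXZ.VN L i q₀ kp km (ε i) a₂ a₃ n := by
      rw [XXZ.VN, XXZ.VN, hθ.2 hmn]
    have h1 : t + N - 1 + 1 = t + N := by omega
    have h2 : t + N - 1 + 2 = t + 1 + N := by omega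
    rw [h1, h2, hper (m := t + N) (n := t) (Nat.add_mod_right _ _),
      hper (m := t + 1 + N) (n := (t + 1) % N)
        ((Nat.add_mod_right _ _).trans (Nat.mod_mod _ _).symm),
      hper (m := t + N - 1) (n := (t + N - 1) % N) (Nat.mod_mod _ _).symm] at hmap
    exact hmap
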